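/- Conventions. A free Borel flow is a free Borel action $(\omega,r)\mapsto\omega+r$ of $\mathbb R$ on a standard Borel space $\Omega$. A cross section of it is a Borel set $\mathcal C\subseteq\Omega$ that meets every orbit, that is lacunary (there is $c>0$ such that $x\in\mathcal C$, $r>0$ and $x+r\in\mathcal C$ imply $r\ge c$), and in which every point has a successor and a predecessor in the same orbit. For a set $S$ of positive reals, $\mathcal C$ is $S$-regular if for every $x\in\mathcal C$ the distance from $x$ to the next point of $\mathcal C$, i.e. the least $r>0$ with $x+r\in\mathcal C$, belongs to $S$. The subgroup of $\mathbb R$ generated by $S$ is denoted by $\langle S\rangle$. The odometer $\sigma:2^{\mathbb N}\to 2^{\mathbb N}$ is given by $\sigma(1^n0y)=0^n1y$ and $\sigma(1^\infty)=0^\infty$; it is a free Borel automorphism of the Cantor space. For $\alpha>0$, the flow under the constant function $\alpha$ with base automorphism $\sigma$ is the free Borel flow on $2^{\mathbb N}\times[0,\alpha)$ given by $$(x,t)+r=\bigl(\sigma^{k}(x),\,t+r-k\alpha\bigr),\qquad k=\lfloor (t+r)/\alpha\rfloor .$$ Proposition 4.3. Let $S\subseteq\mathbb R^{>0}$ be a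 non-empty set bounded away from zero such that - $\langle S\rangle$ is dense in $\mathbb R$; - all elements of $S$ are pairwise rationally dependent, i.e. $\langle S\rangle\subseteq\beta\mathbb Q$ for some $\beta\in\mathbb R^{>0}$ (in particular $\langle S\rangle=\beta\mathbb Q$ is allowed); - $S\cap[0,n]$ is finite for every $n\in\mathbb N$. Let $\alpha\in\mathbb R^{>0}$ be rationally independent from $\beta$. Then the flow under the constant function $\alpha$ over $2^{\mathbb N}$ with the odometer $\sigma$ as base automorphism does not admit an $S$-regular cross section. Moreover, the set $S=\bigl\{\sum_{i=1}^n \tfrac1i : n\ge1\bigr\}$ of partial sums of the harmonic series satisfies all these conditions with $\beta=1$, and in fact $\langle S\rangle=\mathbb Q$. -/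

import Mathlib

/-- A free Borel flow: a free Borel measurable action of the additive group `ℝ` on a standard
Borel space `Ω`. Here `act r ω` is the point written `ω + r`. -/
structure FreeBorelFlow (Ω : Type*) [MeasurableSpace Ω] [StandardBorelSpace Ω] where
  act : ℝ → Ω → Ω
  act_zero : ∀ ω, act 0 ω = ω
  act_add : ∀ r s ω, act (r + s) ω = act r (act s ω)
  measurable_act : Measurable (fun p : ℝ × Ω => act p.1 p.2)
  free : ∀ r ω, act r ω = ω → r = 0

namespace FreeBorelFlow

/-- `F.IsGap C x r` says that `r` is the distance from `x` to the next point of `C`, i.e. the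
least `r > 0` such that `x + r ∈ C`. -/
def IsGap {Ω : Type*} [MeasurableSpace Ω] [StandardBorelSpace Ω] (F : FreeBorelFlow Ω)
    (C : Set Ω) (x : Ω) (r : ℝ) : Prop :=
  IsLeast {r : ℝ | 0 < r ∧ F.act r x ∈ C} r

/-- Cross sections: Borel sets meeting every orbit in a non-empty lacunary set which is
bi-infinite, i.e. each of its points has a successor and a predecessor in the set. -/
structure IsCrossSection {Ω : Type*} [MeasurableSpace Ω] [StandardBorelSpace Ω]
    (F : FreeBorelFlow Ω) (C : Set Ω) : Prop where
  measurableSet : MeasurableSet C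
  meets_orbit : ∀ ω, ∃ r, F.act r ω ∈ C
  lacunary : ∃ c : ℝ, 0 < c ∧ ∀ x ∈ C, ∀ r : ℝ, 0 < r → F.act r x ∈ C → c ≤ r
  exists_next : ∀ x ∈ C, ∃ r, F.IsGap C x r
  exists_prev : ∀ x ∈ C, ∃ y ∈ C, ∃ r, F.IsGap C y r ∧ F.act r y = x

/-- An `S`-regular cross section: all distances between adjacent points belong to `S`. -/
structure IsRegularCrossSection {Ω : Type*} [MeasurableSpace Ω] [StandardBorelSpace Ω]
    (F : FreeBorelFlow Ω) (S : Set ℝ) (C : Set Ω) : Prop extends F.IsCrossSection C where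
  gap_mem : ∀ x ∈ C, ∀ r, F.IsGap C x r → r ∈ S

end FreeBorelFlow

/-- A free Borel automorphism of a measurable space: a bijection, Borel in both directions, all of
whose orbits are infinite. -/
structure FreeBorelAut (X : Type*) [MeasurableSpace X] where
  toPerm : Equiv.Perm X
  measurable_toPerm : Measurable toPerm
  measurable_symm : Measurable toPerm.symm
  free : ∀ (k : ℤ) (x : X), (toPerm ^ k) x = x → k = 0

theorem FreeBorelAut.measurable_zpow {X : Type*} [MeasurableSpace X] (T : FreeBorelAut X)
    (k : ℤ) : Measurable (T.toPerm ^ k : Equiv.Perm X) := by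
  have hnat : ∀ (e : Equiv.Perm X), Measurable e → ∀ n : ℕ, Measurable (e ^ n : Equiv.Perm X) := by
    intro e he n
    induction n with
    | zero => exact measurable_id
    | succ n ih =>
      rw [pow_succ]
      exact ih.comp he
  cases k with
  | ofNat n => simpa using hnat _ T.measurable_toPerm n
  | negSucc n =>
    rw [zpow_negSucc, ← inv_pow]
    exact hnat _ T.measurable_symm (n + 1)

instance standardBorelSpace_Ico (a b : ℝ) : StandardBorelSpace (Set.Ico a b) :=
  measurableSet_Ico.standardBorel

/-- The flow under the constant function `α` with base automorphism `T`: the point `(x, t)` of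
`X × [0, α)` moves upwards at unit speed, and on reaching height `α` it jumps to `(T x, 0)`. In time
`r` (of any sign) the roof is crossed `⌊(t + r) / α⌋` times. -/
noncomputable def FreeBorelAut.flowUnder {X : Type*} [MeasurableSpace X] [StandardBorelSpace X]
    (T : FreeBorelAut X) (α : ℝ) (hα : 0 < α) : FreeBorelFlow (X × Set.Ico (0 : ℝ) α) where
  act r p := ((T.toPerm ^ ⌊((p.2 : ℝ) + r) / α⌋) p.1,
    ⟨(p.2 : ℝ) + r - ⌊((p.2 : ℝ) + r) / α⌋ * α,
      Int.sub_floor_div_mul_nonneg _ hα, Int.sub_floor_div_mul_lt _ hα⟩)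
  act_zero := by
    rintro ⟨x, t, ht0, ht1⟩
    have h : ⌊(t + 0) / α⌋ = 0 := by
      rw [Int.floor_eq_zero_iff, add_zero]
      exact ⟨by positivity, (div_lt_one hα).2 ht1⟩
    ext
    · simp only [h]; simp
    · simp only [h]; simp
  act_add := by
    rintro r s ⟨x, t, ht0, ht1⟩
    have h : ⌊(t + (r + s)) / α⌋ = ⌊(t + s - ⌊(t + s) / α⌋ * α + r) / α⌋ + ⌊(t + s) / α⌋ := by
      rw [← Int.floor_add_intCast]
      congr 1
      field_simp
      ring
    ext
    · simp only [h, zpow_add]; rfl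
    · simp only [h]; push_cast; ring
  measurable_act := by
    have hk : Measurable (fun p : ℝ × (X × Set.Ico (0 : ℝ) α) => ⌊((p.2.2 : ℝ) + p.1) / α⌋) := by
      fun_prop
    have hz : Measurable (fun q : ℤ × X => (T.toPerm ^ q.1) q.2) :=
      measurable_from_prod_countable_right fun k => T.measurable_zpow k
    refine Measurable.prodMk ?_ (Measurable.subtype_mk ?_)
    · exact hz.comp (hk.prodMk (measurable_fst.comp measurable_snd))
    · have hk' : Measurable
          (fun p : ℝ × (X × Set.Ico (0 : ℝ) α) => ((⌊((p.2.2 : ℝ) + p.1) / α⌋ : ℤ) : ℝ)) :=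
        (measurable_from_top (f := fun k : ℤ => (k : ℝ))).comp hk
      fun_prop
  free := by
    rintro r ⟨x, t, ht0, ht1⟩ h
    have h1 := T.free _ _ (congrArg Prod.fst h)
    have h2 := congrArg (fun p => (p.2 : ℝ)) h
    simp only at h1 h2
    rw [h1] at h2
    simpa using h2

/-- One step of the odometer on `2^ℕ`, adding `1` with carry: `1ⁿ0*` goes to `0ⁿ1*`, and `1^∞` goes
to `0^∞`. The `n`-th digit is flipped exactly when all the earlier ones are `1`. -/
def odometerFun (x : ℕ → Bool) : ℕ → Bool :=
  fun n => if ∀ k < n, x k = true then !(x n) else x n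

/-- The inverse of the odometer: `0ⁿ1*` goes to `1ⁿ0*`, and `0^∞` goes to `1^∞`. -/
def odometerInv (x : ℕ → Bool) : ℕ → Bool :=
  fun n => if ∀ k < n, x k = false then !(x n) else x n

theorem odometerFun_all_false (x : ℕ → Bool) (n : ℕ) :
    (∀ k < n, odometerFun x k = false) ↔ ∀ k < n, x k = true := by
  induction n with
  | zero => simp
  | succ n ih =>
    rw [Nat.forall_lt_succ_right, Nat.forall_lt_succ_right, ih]
    refine and_congr_right fun h => ?_
    simp [odometerFun, if_pos h]

theorem odometerInv_all_true (x : ℕ → Bool) (n : ℕ) :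
    (∀ k < n, odometerInv x k = true) ↔ ∀ k < n, x k = false := by
  induction n with
  | zero => simp
  | succ n ih =>
    rw [Nat.forall_lt_succ_right, Nat.forall_lt_succ_right, ih]
    refine and_congr_right fun h => ?_
    simp [odometerInv, if_pos h]

theorem odometerInv_odometerFun (x : ℕ → Bool) : odometerInv (odometerFun x) = x := by
  funext n
  by_cases h : ∀ k < n, x k = true
  · rw [odometerInv, if_pos ((odometerFun_all_false x n).2 h), odometerFun, if_pos h, Bool.not_not]
  · rw [odometerInv, if_neg (fun h' => h ((odometerFun_all_false x n).1 h')), odometerFun, if_neg h]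

theorem odometerFun_odometerInv (x : ℕ → Bool) : odometerFun (odometerInv x) = x := by
  funext n
  by_cases h : ∀ k < n, x k = false
  · rw [odometerFun, if_pos ((odometerInv_all_true x n).2 h), odometerInv, if_pos h, Bool.not_not]
  · rw [odometerFun, if_neg (fun h' => h ((odometerInv_all_true x n).1 h')), odometerInv, if_neg h]

/-- The number whose binary expansion, least significant digit first, is `x 0, …, x (n - 1)`. -/
def binaryValue (x : ℕ → Bool) (n : ℕ) : ℤ :=
  ∑ i ∈ Finset.range n, if x i = true then 2 ^ i else 0

theorem binaryValue_odometerFun (x : ℕ → Bool) (n : ℕ) :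
    binaryValue (odometerFun x) n =
      binaryValue x n + 1 - if ∀ k < n, x k = true then 2 ^ n else 0 := by
  induction n with
  | zero => simp [binaryValue]
  | succ n ih =>
    unfold binaryValue at ih ⊢
    rw [Finset.sum_range_succ, Finset.sum_range_succ, ih]
    by_cases h : ∀ k < n, x k = true
    · cases hx : x n
      · have h' : ¬ ∀ k < n + 1, x k = true := fun H => by simp [H n (Nat.lt_succ_self n)] at hx
        rw [if_pos h, if_neg h']
        simp [odometerFun, if_pos h, hx]
      · have h' : ∀ k < n + 1, x k = true := Nat.forall_lt_succ_right.2 ⟨h, hx⟩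
        rw [if_pos h, if_pos h']
        simp [odometerFun, if_pos h, hx]
        ring
    · have h' : ¬ ∀ k < n + 1, x k = true := fun H => h fun k hk => H k (Nat.lt_succ_of_lt hk)
      rw [if_neg h, if_neg h']
      simp only [odometerFun, if_neg h]
      ring

/-- The odometer as a free Borel automorphism of the Cantor space `2^ℕ`. -/
def odometer : FreeBorelAut (ℕ → Bool) where
  toPerm :=
    { toFun := odometerFun
      invFun := odometerInv
      left_inv := odometerInv_odometerFun
      right_inv := odometerFun_odometerInv }
  measurable_toPerm := by
    refine measurable_pi_iff.2 fun n => Measurable.ite ?_ ?_ (measurable_pi_apply n)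
    · have h : {x : ℕ → Bool | ∀ k < n, x k = true} = ⋂ k : ℕ, ⋂ _ : k < n, {x | x k = true} := by
        ext x
        simp
      rw [h]
      refine MeasurableSet.iInter fun k => MeasurableSet.iInter fun _ => ?_
      have hk : Measurable (fun x : ℕ → Bool => x k) := measurable_pi_apply k
      exact hk (measurableSet_singleton true)
    · exact (measurable_from_top (f := Bool.not)).comp (measurable_pi_apply n)
  measurable_symm := by
    refine measurable_pi_iff.2 fun n => Measurable.ite ?_ ?_ (measurable_pi_apply n)
    · have h : {x : ℕ → Bool | ∀ k < n, x k = false} = ⋂ k : ℕ, ⋂ _ : k < n, {x | x k = false} := by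
        ext x
        simp
      rw [h]
      refine MeasurableSet.iInter fun k => MeasurableSet.iInter fun _ => ?_
      have hk : Measurable (fun x : ℕ → Bool => x k) := measurable_pi_apply k
      exact hk (measurableSet_singleton false)
    · exact (measurable_from_top (f := Bool.not)).comp (measurable_pi_apply n)
  free := by
    set σ : Equiv.Perm (ℕ → Bool) :=
      { toFun := odometerFun
        invFun := odometerInv
        left_inv := odometerInv_odometerFun
        right_inv := odometerFun_odometerInv } with hσ
    have hstep : ∀ (n : ℕ) (x : ℕ → Bool),
        ((binaryValue (σ x) n : ℤ) : ZMod (2 ^ n)) = (binaryValue x n : ZMod (2 ^ n)) + 1 := by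
      intro n x
      have h2 : ((2 : ZMod (2 ^ n)) ^ n) = 0 := by
        have := ZMod.natCast_self (2 ^ n)
        push_cast at this
        exact this
      have : binaryValue (σ x) n = _ := binaryValue_odometerFun x n
      rw [this]
      split_ifs <;> push_cast <;> simp [h2]
    have hz : ∀ (n : ℕ) (k : ℤ) (x : ℕ → Bool),
        ((binaryValue ((σ ^ k) x) n : ℤ) : ZMod (2 ^ n)) = (binaryValue x n : ZMod (2 ^ n)) + k := by
      intro n k
      induction k using Int.induction_on with
      | zero => simp
      | succ i ih =>
        intro x
        rw [zpow_add_one, Equiv.Perm.mul_apply, ih, hstep]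
        push_cast
        ring
      | pred i ih =>
        intro x
        have h := hstep n (σ⁻¹ x)
        have hxx : σ (σ⁻¹ x) = x := Equiv.apply_symm_apply σ x
        rw [hxx] at h
        rw [zpow_sub_one, Equiv.Perm.mul_apply, ih, h]
        push_cast
        ring
    intro k x hkx
    by_contra hk
    have h := hz k.natAbs k x
    rw [hkx, left_eq_add, ZMod.intCast_zmod_eq_zero_iff_dvd] at h
    have h1 := Int.natAbs_dvd_natAbs.2 h
    have h2 := Nat.le_of_dvd (Int.natAbs_pos.2 hk) h1
    simp only [Int.natAbs_natCast] at h2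
    exact absurd h2 (not_le.2 Nat.lt_two_pow_self)

/-- The set `βℚ` of rational multiples of `β`. -/
def rationalMultiples (β : ℝ) : Set ℝ := Set.range fun q : ℚ => β * (q : ℝ)

/-- A non-empty set of positive reals, bounded away from zero and finite on bounded intervals, whose
elements are rational multiples of the positive real `β` (so they are pairwise rationally dependent)
and generate a dense subgroup of `ℝ`. -/
structure IsDenseCommensurable (S : Set ℝ) (β : ℝ) : Prop where
  nonempty : S.Nonempty
  pos : ∀ s ∈ S, 0 < s
  bounded_away : ∃ c : ℝ, 0 < c ∧ ∀ s ∈ S, c ≤ s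
  dense : Dense (AddSubgroup.closure S : Set ℝ)
  base_pos : 0 < β
  closure_subset : (AddSubgroup.closure S : Set ℝ) ⊆ rationalMultiples β
  finite : ∀ n : ℕ, (S ∩ Set.Icc (0 : ℝ) n).Finite

/-- The set of partial sums of the harmonic series. -/
def harmonicPartialSums : Set ℝ :=
  {s | ∃ n : ℕ, 1 ≤ n ∧ s = ∑ i ∈ Finset.Icc 1 n, 1 / (i : ℝ)}

open Filter Topology

/-! The argument is by Baire category on the Cantor space. If `C` were a regular cross section,
countably many odometer translates of its Borel projection would cover the base, so one is comeager
in some open set. Every non-empty open set contains a cylinder that some power `2 ^ n` of the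
odometer preserves, so over a generic point `C` recurs at bounded intervals. The gaps along that
forward orbit are then bounded, hence come from finitely many elements of `S`, and commensurability
puts them all in one cyclic group `γℤ`.

A second use of Baire category, on thin slabs of heights, gives a generic point with returns after
`m * 2 ^ l * α`, up to an error below `γ / 3`, for all `m`. These return times are sums of gaps, so
they lie in `γℤ`. This forces the errors to be additive in `m`; being bounded, they vanish
(`mem_zmultiples_of_bounded_error`). Hence `2 ^ l * α ∈ γℤ ⊆ βℚ`, contradicting independence. -/

theorem exists_isOpen_residual_of_countable_cover {X ι : Type*} [TopologicalSpace X] [BaireSpace X]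
    [MeasurableSpace X] [BorelSpace X] [Countable ι] {V : Set X} (hV : IsOpen V)
    (hVne : V.Nonempty) {B : ι → Set X} (hB : ∀ i, MeasurableSet (B i))
    (hcov : ∀ᶠ x in residual X, x ∈ V → ∃ i, x ∈ B i) :
    ∃ i, ∃ U ⊆ V, IsOpen U ∧ U.Nonempty ∧ ∀ᶠ x in residual X, x ∈ U → x ∈ B i := by
  -- Borel sets have the Baire property. If no `V ∩ u i` could serve as `U`, all would be empty and
  -- the non-empty open set `V` would be meagre.
  choose u hu hBu using fun i => (hB i).residualEq_isOpen
  by_contra! h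
  have hd : ∀ i, V ∩ u i = ∅ := by
    intro i
    by_contra hne
    refine h i (V ∩ u i) Set.inter_subset_left (hV.inter (hu i))
      (Set.nonempty_iff_ne_empty.2 hne) ?_
    filter_upwards [Filter.eventuallyEq_set.1 (hBu i)] with x hx hxu
    exact hxu.2 (hx.2 hxu.1.2)
  have hnot : ∀ᶠ x in residual X, x ∉ V := by
    filter_upwards [hcov, eventually_countable_forall.2 fun i =>
      Filter.eventuallyEq_set.1 (hBu i)] with x hx hx' hxV
    obtain ⟨i, hi⟩ := hx hxV
    have : x ∈ V ∩ u i := ⟨hxV, (hx' i).1 hi⟩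
    simp [hd i] at this
  obtain ⟨x, hx, hx'⟩ := (dense_of_mem_residual hnot).inter_open_nonempty V hV hVne
  exact hx' hx

/-! ### Topological dynamics of the odometer -/

theorem continuous_odometerFun : Continuous odometerFun := by
  refine continuous_pi fun n => ?_
  have h : IsClopen {x : ℕ → Bool | ∀ k < n, x k = true} := by
    have : {x : ℕ → Bool | ∀ k < n, x k = true} = ⋂ k ∈ Finset.range n, {x | x k = true} := by
      ext x
      simp
    rw [this]
    exact isClopen_biInter_finset fun k _ =>
      (isClopen_discrete {true}).preimage (continuous_apply k)
  refine continuous_if (fun a ha => ?_) ?_ ?_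
  · rw [h.frontier_eq] at ha
    exact ha.elim
  · exact ((continuous_of_discreteTopology (f := Bool.not)).comp (continuous_apply n)).continuousOn
  · exact (continuous_apply n).continuousOn

theorem continuous_odometerInv : Continuous odometerInv := by
  refine continuous_pi fun n => ?_
  have h : IsClopen {x : ℕ → Bool | ∀ k < n, x k = false} := by
    have : {x : ℕ → Bool | ∀ k < n, x k = false} = ⋂ k ∈ Finset.range n, {x | x k = false} := by
      ext x
      simp
    rw [this]
    exact isClopen_biInter_finset fun k _ =>
      (isClopen_discrete {false}).preimage (continuous_apply k)
  refine continuous_if (fun a ha => ?_) ?_ ?_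
  · rw [h.frontier_eq] at ha
    exact ha.elim
  · exact ((continuous_of_discreteTopology (f := Bool.not)).comp (continuous_apply n)).continuousOn
  · exact (continuous_apply n).continuousOn

/-- The odometer as a self-homeomorphism of the Cantor space. -/
def odometerHomeomorph : (ℕ → Bool) ≃ₜ (ℕ → Bool) where
  toEquiv := odometer.toPerm
  continuous_toFun := continuous_odometerFun
  continuous_invFun := continuous_odometerInv

theorem eventually_residual_odometer_pow {p : (ℕ → Bool) → Prop}
    (hp : ∀ᶠ x in residual (ℕ → Bool), p x) :
    ∀ᶠ x in residual (ℕ → Bool), ∀ m : ℕ, p ((odometer.toPerm ^ m) x) := by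
  refine eventually_countable_forall.2 fun m => ?_
  induction m with
  | zero => simpa using hp
  | succ m ih =>
    have := (tendsto_residual_of_isOpenMap odometerHomeomorph.continuous
      odometerHomeomorph.isOpenMap).eventually ih
    filter_upwards [this] with x hx
    rw [pow_succ]
    exact hx

theorem odometerFun_odometerFun_zero (x : ℕ → Bool) :
    odometerFun (odometerFun x) 0 = x 0 := by
  simp [odometerFun]

/-- Adding 1 twice produces exactly one carry out of digit 0, so the square acts on the tail as a
single odometer step. -/
theorem odometerFun_odometerFun_succ (x : ℕ → Bool) (k : ℕ) :
    odometerFun (odometerFun x) (k + 1) = odometerFun (fun j => x (j + 1)) k := by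
  have key : ∀ (y : ℕ → Bool) (k : ℕ), odometerFun y (k + 1) =
      if y 0 = true then odometerFun (fun j => y (j + 1)) k else y (k + 1) := by
    intro y k
    by_cases h0 : y 0 = true
    · simp only [odometerFun, h0, if_true]
      congr 1
      simp only [eq_iff_iff]
      refine ⟨fun h j hj => h (j + 1) (by omega), fun h j hj => ?_⟩
      cases j with
      | zero => exact h0
      | succ j => exact h j (by omega)
    · rw [if_neg h0, odometerFun, if_neg fun h => h0 (h 0 (by omega))]
  have h0 : odometerFun x 0 = !x 0 := by simp [odometerFun]
  rw [key (odometerFun x), h0]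
  cases hx : x 0
  · simp only [Bool.not_false, if_true]
    congr 1
    funext j
    rw [key, hx]
    simp
  · simp [key x, hx]

theorem odometerFun_iterate_two_pow (n : ℕ) : ∀ x : ℕ → Bool,
    (∀ k < n, odometerFun^[2 ^ n] x k = x k) ∧
      ∀ k, odometerFun^[2 ^ n] x (n + k) = odometerFun (fun j => x (n + j)) k := by
  induction n with
  | zero => simp
  | succ n ih =>
    intro x
    obtain ⟨h1, h2⟩ := ih x
    obtain ⟨h3, h4⟩ := ih (odometerFun^[2 ^ n] x)
    simp only [h2] at h4
    have hs : odometerFun^[2 ^ (n + 1)] x = odometerFun^[2 ^ n] (odometerFun^[2 ^ n] x) := by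
      rw [← Function.iterate_add_apply, pow_succ, mul_two]
    rw [hs]
    constructor
    · intro k hk
      rcases Nat.lt_succ_iff_lt_or_eq.1 hk with hk | rfl
      · rw [h3 k hk, h1 k hk]
      · simpa using (h4 0).trans (odometerFun_odometerFun_zero _)
    · intro k
      rw [show n + 1 + k = n + (k + 1) by ring, h4 (k + 1)]
      refine (odometerFun_odometerFun_succ _ _).trans ?_
      simp only [add_assoc, add_comm 1]

theorem odometer_pow_two_pow_mul_apply (n m : ℕ) (x : ℕ → Bool) {k : ℕ} (hk : k < n) :
    (odometer.toPerm ^ (2 ^ n * m)) x k = x k := by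
  induction m with
  | zero => simp
  | succ m ih =>
    rw [Nat.mul_succ, add_comm, pow_add, Equiv.Perm.mul_apply, ← ih]
    have := (odometerFun_iterate_two_pow n ((odometer.toPerm ^ (2 ^ n * m)) x)).1 k hk
    rw [← this, ← Equiv.Perm.iterate_eq_pow odometer.toPerm (2 ^ n)]
    rfl

/-- Adding a multiple of `2 ^ n` does not change the first `n` digits, so any cylinder of length `n`
works. -/
theorem exists_odometer_pow_mem {U : Set (ℕ → Bool)} (hU : IsOpen U) (hne : U.Nonempty) :
    ∃ V ⊆ U, IsOpen V ∧ V.Nonempty ∧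
      ∃ n : ℕ, ∀ x ∈ V, ∀ m : ℕ, (odometer.toPerm ^ (2 ^ n * m)) x ∈ V := by
  obtain ⟨u, hu⟩ := hne
  obtain ⟨_, ⟨y, n, rfl⟩, hyu, hyU⟩ :=
    (PiNat.isTopologicalBasis_cylinders (fun _ : ℕ => Bool)).exists_subset_of_mem_open hu hU
  refine ⟨_, hyU, PiNat.isOpen_cylinder _ y n, ⟨u, hyu⟩, n, fun x hx m => ?_⟩
  rw [PiNat.mem_cylinder_iff] at hx ⊢
  exact fun i hi => (odometer_pow_two_pow_mul_apply n m x hi).trans (hx i hi)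

/-! ### Return times and projections of cross sections -/

namespace FreeBorelFlow

theorem IsCrossSection.mem_zmultiples_of_return {Ω : Type*} [MeasurableSpace Ω]
    [StandardBorelSpace Ω] {F : FreeBorelFlow Ω} {C : Set Ω} (hC : F.IsCrossSection C) {γ : ℝ}
    {ω : Ω} (hω : ω ∈ C)
    (hgap : ∀ a, 0 ≤ a → F.act a ω ∈ C → ∀ s, F.IsGap C (F.act a ω) s →
      s ∈ AddSubgroup.zmultiples γ) {r : ℝ} (hr : 0 ≤ r) (hrC : F.act r ω ∈ C) :
    r ∈ AddSubgroup.zmultiples γ := by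
  obtain ⟨c, hc, hlac⟩ := hC.lacunary
  obtain ⟨n, hn⟩ := exists_nat_ge (r / c)
  rw [div_le_iff₀ hc] at hn
  -- A return time is a sum of gaps; each gap is at least `c`, so removing the first one lowers the
  -- bound `n * c` by a step.
  induction n generalizing ω r with
  | zero =>
    have : r = 0 := le_antisymm (by simpa using hn) hr
    rw [this]
    exact zero_mem _
  | succ n ih =>
    rcases hr.eq_or_lt with rfl | hr'
    · exact zero_mem _
    obtain ⟨s, hs⟩ := hC.exists_next ω hω
    have hcs := hlac ω hω s hs.1.1 hs.1.2
    have hsr : s ≤ r := hs.2 ⟨hr', hrC⟩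
    have hs' := hgap 0 le_rfl (by rwa [F.act_zero]) s (by rwa [F.act_zero])
    have hrs : r - s ∈ AddSubgroup.zmultiples γ := by
      refine ih hs.1.2 (fun a ha => ?_) (sub_nonneg.2 hsr) ?_ ?_
      · rw [← F.act_add]
        exact hgap (a + s) (add_nonneg ha hs.1.1.le)
      · rwa [← F.act_add, sub_add_cancel]
      · push_cast at hn
        linarith
    simpa using add_mem hrs hs'

end FreeBorelFlow

theorem FreeBorelAut.flowUnder_act {X : Type*} [MeasurableSpace X] [StandardBorelSpace X]
    (T : FreeBorelAut X) (α : ℝ) (hα : 0 < α) (m : ℤ) (x : X) (t t' : Set.Ico (0 : ℝ) α) :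
    (T.flowUnder α hα).act (m * α + t' - t) (x, t) = ((T.toPerm ^ m) x, t') := by
  have h : ⌊((t : ℝ) + (m * α + t' - t)) / α⌋ = m := by
    rw [Int.floor_eq_iff, le_div_iff₀ hα, div_lt_iff₀ hα]
    constructor <;> linarith [t'.2.1, t'.2.2]
  refine Prod.ext ?_ (Subtype.ext ?_)
  · simp only [FreeBorelAut.flowUnder, h]
  · simp only [FreeBorelAut.flowUnder, h]
    ring

/-- A slab of height at most `c` meets `C` at most once in each fibre, so the projection is
injective there and Lusin–Souslin applies. -/
theorem FreeBorelAut.measurableSet_image_fst_inter_floor {X : Type*} [MeasurableSpace X]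
    [StandardBorelSpace X] (T : FreeBorelAut X) {α : ℝ} {hα : 0 < α}
    {C : Set (X × Set.Ico (0 : ℝ) α)} (hC : MeasurableSet C) {c : ℝ}
    (hlac : ∀ x ∈ C, ∀ r : ℝ, 0 < r → (T.flowUnder α hα).act r x ∈ C → c ≤ r)
    {η : ℝ} (hη : 0 < η) (hηc : η ≤ c) (i : ℤ) :
    MeasurableSet (Prod.fst '' (C ∩ {p | ⌊(p.2 : ℝ) / η⌋ = i})) := by
  have hm : Measurable fun p : X × Set.Ico (0 : ℝ) α => ⌊(p.2 : ℝ) / η⌋ := by fun_prop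
  refine (hC.inter (hm (measurableSet_singleton i))).image_of_measurable_injOn measurable_fst ?_
  have hle : ∀ (x : X) (t t' : Set.Ico (0 : ℝ) α), (x, t) ∈ C → (x, t') ∈ C →
      ⌊(t : ℝ) / η⌋ = i → ⌊(t' : ℝ) / η⌋ = i → t' ≤ t := by
    intro x t t' h h' hi hi'
    by_contra hlt
    have hlt : (t : ℝ) < t' := not_le.1 hlt
    have hact := T.flowUnder_act α hα 0 x t t'
    simp only [Int.cast_zero, zero_mul, zero_add, zpow_zero, Equiv.Perm.one_apply] at hact
    have := hlac (x, t) h (t' - t) (sub_pos.2 hlt) (by rwa [hact])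
    have hb := Int.abs_sub_lt_one_of_floor_eq_floor (hi'.trans hi.symm)
    rw [← sub_div, abs_lt, div_lt_iff₀ hη] at hb
    linarith [hb.2]
  rintro ⟨x, t⟩ ⟨h, hi⟩ ⟨x', t'⟩ ⟨h', hi'⟩ (rfl : x = x')
  exact Prod.ext rfl (le_antisymm (hle x t' t h' h hi' hi) (hle x t t' h h' hi hi'))

/-! ### Arithmetic of cyclic subgroups -/

theorem exists_pos_zmultiples_of_finite {β : ℝ} (hβ : 0 < β) {A : Set ℝ} (hA : A.Finite)
    (hsub : A ⊆ rationalMultiples β) :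
    ∃ q : ℚ, 0 < q ∧ ∀ s ∈ A, s ∈ AddSubgroup.zmultiples (β * (q : ℝ)) := by
  induction A, hA using Set.Finite.induction_on with
  | empty => exact ⟨1, one_pos, by simp⟩
  | @insert a A _ _ ih =>
    obtain ⟨q, hq, h⟩ := ih ((Set.subset_insert _ _).trans hsub)
    obtain ⟨p, rfl⟩ := hsub (Set.mem_insert a A)
    -- Dividing `q` by the denominator of `p / q` gives a common divisor of `p` and `q`.
    have hd : 0 < (p / q).den := (p / q).den_pos
    have hd' : ((p / q).den : ℚ) ≠ 0 := by exact_mod_cast hd.ne'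
    have hmul : AddSubgroup.zmultiples (β * (q : ℝ)) ≤
        AddSubgroup.zmultiples (β * ((q / (p / q).den : ℚ) : ℝ)) := by
      rw [AddSubgroup.zmultiples_le]
      refine AddSubgroup.mem_zmultiples_iff.2 ⟨(p / q).den, ?_⟩
      have hd'' : ((p / q).den : ℝ) ≠ 0 := by exact_mod_cast hd.ne'
      push_cast
      simp only [zsmul_eq_mul, Int.cast_natCast]
      field_simp
    refine ⟨q / (p / q).den, by positivity, ?_⟩
    rintro s (rfl | hs)
    · refine AddSubgroup.mem_zmultiples_iff.2 ⟨(p / q).num, ?_⟩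
      have : p = (p / q).num * (q / (p / q).den) := by
        conv_lhs => rw [← div_mul_cancel₀ p hq.ne', ← Rat.num_div_den (p / q)]
        ring
      simp only [zsmul_eq_mul]
      conv_rhs => rw [this]
      push_cast
      ring
    · exact hmul (h s hs)

theorem mem_zmultiples_of_bounded_error {θ γ : ℝ} (hγ : 0 < γ) {e : ℕ → ℝ} (he0 : e 0 = 0)
    (he : ∀ m, |e m| < γ / 3) (h : ∀ m : ℕ, m * θ + e m ∈ AddSubgroup.zmultiples γ) :
    θ ∈ AddSubgroup.zmultiples γ := by
  -- The defect combines three errors, each below `γ / 3`, so it is a multiple of `γ` of absolute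
  -- value below `γ`.
  have hstep : ∀ m, e (m + 1) = e m + e 1 := by
    intro m
    have hz := sub_mem (sub_mem (h (m + 1)) (h m)) (h 1)
    obtain ⟨z, hz⟩ := AddSubgroup.mem_zmultiples_iff.1 hz
    have hz' : (z : ℝ) * γ = e (m + 1) - e m - e 1 := by
      rw [zsmul_eq_mul] at hz
      rw [hz]
      push_cast
      ring
    have h1 := abs_lt.1 (he (m + 1))
    have h2 := abs_lt.1 (he m)
    have h3 := abs_lt.1 (he 1)
    have hz1 : (z : ℝ) < 1 := by
      by_contra! hc
      nlinarith
    have hz2 : (-1 : ℝ) < z := by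
      by_contra! hc
      nlinarith
    have hz0 : z = 0 := by
      have : z < 1 := by exact_mod_cast hz1
      have : -1 < z := by exact_mod_cast hz2
      omega
    rw [hz0] at hz'
    simp only [Int.cast_zero, zero_mul] at hz'
    linarith
  have hlin : ∀ m : ℕ, e m = m * e 1 := by
    intro m
    induction m with
    | zero => simp [he0]
    | succ m ih =>
      rw [hstep, ih]
      push_cast
      ring
  have he1 : e 1 = 0 := by
    by_contra hne
    obtain ⟨m, hm⟩ := exists_nat_gt (γ / 3 / |e 1|)
    have := he m
    rw [hlin, abs_mul, Nat.abs_cast] at this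
    rw [div_lt_iff₀ (abs_pos.2 hne)] at hm
    linarith
  simpa [he1] using h 1

theorem mul_ratCast_not_mem_zmultiples {α β : ℝ} (h : LinearIndependent ℚ ![α, β]) {p : ℚ}
    (hp : p ≠ 0) (q : ℚ) : (p : ℝ) * α ∉ AddSubgroup.zmultiples (β * (q : ℝ)) := by
  intro hmem
  obtain ⟨z, hz⟩ := AddSubgroup.mem_zmultiples_iff.1 hmem
  rw [LinearIndependent.pair_iff] at h
  refine hp (h p (-(z * q)) ?_).1
  rw [Rat.smul_def, Rat.smul_def, ← hz]
  push_cast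
  rw [zsmul_eq_mul]
  ring

/-! ### The category argument -/

theorem not_exists_isRegularCrossSection_odometer {S : Set ℝ} {β : ℝ} (hβ : 0 < β)
    (hS : S ⊆ rationalMultiples β) (hfin : ∀ n : ℕ, (S ∩ Set.Icc (0 : ℝ) n).Finite) {α : ℝ}
    (hα : 0 < α) (hind : LinearIndependent ℚ ![α, β]) :
    ¬ ∃ C : Set ((ℕ → Bool) × Set.Ico (0 : ℝ) α),
      (odometer.flowUnder α hα).IsRegularCrossSection S C := by
  rintro ⟨C, hC⟩
  set σ := odometer.toPerm with hσ
  obtain ⟨c, hc, hlac⟩ := hC.lacunary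
  have hcell : ∀ {η : ℝ}, 0 < η → η ≤ c → ∀ i : ℤ,
      MeasurableSet (Prod.fst '' (C ∩ {p | ⌊(p.2 : ℝ) / η⌋ = i})) := fun h h' i =>
    odometer.measurableSet_image_fst_inter_floor hC.measurableSet hlac h h' i
  have hproj : MeasurableSet (Prod.fst '' C) := by
    have : Prod.fst '' C = ⋃ i : ℤ, Prod.fst '' (C ∩ {p | ⌊(p.2 : ℝ) / c⌋ = i}) := by
      rw [← Set.image_iUnion, ← Set.inter_iUnion]
      congr 1
      ext p
      simp
    rw [this]
    exact MeasurableSet.iUnion (hcell hc le_rfl)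
  obtain ⟨k, U, -, hUo, hUne, hU⟩ := exists_isOpen_residual_of_countable_cover
    (B := fun k : ℤ => (σ ^ k : Equiv.Perm (ℕ → Bool)) ⁻¹' (Prod.fst '' C)) isOpen_univ
    Set.univ_nonempty (fun k => odometer.measurable_zpow k hproj) <| Eventually.of_forall fun x _ => by
      obtain ⟨r, hr⟩ := hC.meets_orbit (x, ⟨0, le_rfl, hα⟩)
      exact ⟨_, _, hr, rfl⟩
  obtain ⟨V, hVU, hVo, hVne, n, hV⟩ := exists_odometer_pow_mem hUo hUne
  set θ : ℝ := 2 ^ n * α with hθ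
  have hθpos : 0 < θ := by positivity
  obtain ⟨N, hN⟩ := exists_nat_ge (θ + α)
  obtain ⟨q, hq, hqS⟩ := exists_pos_zmultiples_of_finite hβ (hfin N)
    (Set.inter_subset_left.trans hS)
  set γ : ℝ := β * q with hγ
  have hγpos : 0 < γ := by positivity
  have hret : ∀ (x : ℕ → Bool) (t t' : Set.Ico (0 : ℝ) α) (j : ℕ),
      (odometer.flowUnder α hα).act (j * α + t' - t) ((σ ^ k) x, t) =
        ((σ ^ k) ((σ ^ j) x), t') := by
    intro x t t' j
    have := odometer.flowUnder_act α hα j ((σ ^ k) x) t t'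
    rw [Int.cast_natCast] at this
    rw [this, ← hσ, ← Equiv.Perm.mul_apply, ← Equiv.Perm.mul_apply, ← zpow_natCast σ j,
      ← zpow_add, ← zpow_add, add_comm]
  have hgap : ∀ x (t : Set.Ico (0 : ℝ) α),
      (∀ m : ℕ, (σ ^ k) ((σ ^ (2 ^ n * m)) x) ∈ Prod.fst '' C) →
      ∀ a, 0 ≤ a → (odometer.flowUnder α hα).act a ((σ ^ k) x, t) ∈ C →
        ∀ s, (odometer.flowUnder α hα).IsGap C
          ((odometer.flowUnder α hα).act a ((σ ^ k) x, t)) s → s ∈ AddSubgroup.zmultiples γ := by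
    intro x t hx a ha haC s hs
    -- The first multiple of `θ` beyond `a + t` gives a point of `C` strictly after time `a`, at
    -- distance at most `θ + t' < θ + α ≤ N`.
    obtain ⟨m, hm, hm'⟩ : ∃ m : ℕ, a + t < m * θ ∧ m * θ ≤ a + t + θ := by
      have h0 : 0 ≤ (a + t) / θ := div_nonneg (add_nonneg ha t.2.1) hθpos.le
      refine ⟨⌊(a + t) / θ⌋₊ + 1, ?_, ?_⟩
      · rw [← div_lt_iff₀ hθpos]
        exact_mod_cast Nat.lt_floor_add_one ((a + t) / θ)
      · have := Nat.floor_le h0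
        rw [le_div_iff₀ hθpos] at this
        push_cast
        linarith
    obtain ⟨⟨y, t'⟩, hp, rfl : y = _⟩ := hx m
    rw [← hret x t t', ← sub_add_cancel ((_ : ℝ) + t' - t) a, FreeBorelFlow.act_add] at hp
    have hmθ : ((2 ^ n * m : ℕ) : ℝ) * α = m * θ := by
      rw [hθ]
      push_cast
      ring
    rw [hmθ] at hp
    have hle := hs.2 ⟨by linarith [t'.2.1], hp⟩
    exact hqS s ⟨hC.gap_mem _ haC s hs, hs.1.1.le, by linarith [t'.2.2, t.2.1]⟩
  -- The bound `c` makes the slab projections Borel; `γ / 3` makes heights within one slab close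
  -- enough for the error argument.
  set η : ℝ := min c (γ / 3) with hη
  have hηpos : 0 < η := lt_min hc (by positivity)
  obtain ⟨i, W, hWV, hWo, hWne, hW⟩ := exists_isOpen_residual_of_countable_cover
    (B := fun i : ℤ => (σ ^ k : Equiv.Perm (ℕ → Bool)) ⁻¹'
      (Prod.fst '' (C ∩ {p | ⌊(p.2 : ℝ) / η⌋ = i}))) hVo hVne
    (fun i => odometer.measurable_zpow k (hcell hηpos (min_le_left _ _) i)) <| by
      filter_upwards [hU] with x hx hxV
      obtain ⟨p, hp, hpx⟩ := hx (hVU hxV)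
      exact ⟨_, p, ⟨hp, rfl⟩, hpx⟩
  obtain ⟨W', hW'W, hW'o, hW'ne, l, hW'⟩ := exists_odometer_pow_mem hWo hWne
  -- Both comeager conditions must hold along the whole forward orbit of `x`, for steps `2 ^ n` and
  -- `2 ^ l` alike.
  obtain ⟨x, hxW', hx⟩ := (dense_of_mem_residual
    (eventually_residual_odometer_pow (hU.and hW))).inter_open_nonempty W' hW'o hW'ne
  have hxV := hWV (hW'W hxW')
  choose p hp hpx using fun m : ℕ => (hx (2 ^ l * m)).2 (hW'W (hW' x hxW' m))
  have hx0 : ((σ ^ k) x, (p 0).2) ∈ C := by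
    have := (hp 0).1
    rwa [← Prod.mk.eta (p := p 0), hpx 0, mul_zero, pow_zero, Equiv.Perm.one_apply] at this
  have hact : ∀ m : ℕ, (odometer.flowUnder α hα).act
      (m * (2 ^ l * α) + ((p m).2 - (p 0).2)) ((σ ^ k) x, (p 0).2) ∈ C := by
    intro m
    have h := hret x (p 0).2 (p m).2 (2 ^ l * m)
    rw [← hσ] at hpx
    rw [← hpx m] at h
    have h' : (m : ℝ) * (2 ^ l * α) + ((p m).2 - (p 0).2) =
        ((2 ^ l * m : ℕ) : ℝ) * α + (p m).2 - (p 0).2 := by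
      push_cast
      ring
    rw [h', h]
    exact (hp m).1
  have herr : ∀ m, |((p m).2 : ℝ) - (p 0).2| < γ / 3 := by
    intro m
    have := Int.abs_sub_lt_one_of_floor_eq_floor ((hp m).2.trans (hp 0).2.symm)
    rw [← sub_div, abs_div, abs_of_pos hηpos, div_lt_one hηpos] at this
    exact this.trans_le (min_le_right _ _)
  have hmem : (2 ^ l * α : ℝ) ∈ AddSubgroup.zmultiples γ := by
    refine mem_zmultiples_of_bounded_error hγpos (e := fun m => (p m).2 - (p 0).2)
      (sub_self _) herr fun m => ?_
    rcases Nat.eq_zero_or_pos m with rfl | hm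
    · simp
    refine hC.mem_zmultiples_of_return hx0
      (hgap x (p 0).2 fun m => (hx _).1 (hVU (hV x hxV m))) ?_ (hact m)
    -- Heights differ by less than `α`, so the return time is nonnegative once `m ≥ 1`.
    have h1 : α ≤ m * (2 ^ l * α) := by
      rw [← mul_assoc]
      refine le_mul_of_one_le_left hα.le ?_
      exact one_le_mul_of_one_le_of_one_le (by exact_mod_cast hm) (one_le_pow₀ one_le_two)
    linarith [(p m).2.2.1, (p 0).2.2.2]
  refine mul_ratCast_not_mem_zmultiples hind (p := 2 ^ l) (by positivity) q ?_
  push_cast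
  exact hmem

/-! ### The harmonic example -/

theorem harmonicPartialSum_eq_harmonic (n : ℕ) :
    ∑ i ∈ Finset.Icc 1 n, 1 / (i : ℝ) = (harmonic n : ℝ) := by
  rw [harmonic_eq_sum_Icc]
  push_cast
  simp

theorem closure_harmonicPartialSums :
    (AddSubgroup.closure harmonicPartialSums : Set ℝ) = rationalMultiples 1 := by
  have hmem : ∀ n : ℕ, (harmonic n : ℝ) ∈ AddSubgroup.closure harmonicPartialSums := by
    intro n
    rcases Nat.eq_zero_or_pos n with rfl | hn
    · simp
    · exact AddSubgroup.subset_closure ⟨n, hn, (harmonicPartialSum_eq_harmonic n).symm⟩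
  apply Set.Subset.antisymm
  · intro x hx
    induction hx using AddSubgroup.closure_induction with
    | mem x hx =>
      obtain ⟨n, -, rfl⟩ := hx
      exact ⟨harmonic n, (one_mul _).trans (harmonicPartialSum_eq_harmonic n).symm⟩
    | zero => exact ⟨0, by simp⟩
    | add x y _ _ hx hy =>
      obtain ⟨p, rfl⟩ := hx
      obtain ⟨q, rfl⟩ := hy
      exact ⟨p + q, by simp⟩
    | neg x _ hx =>
      obtain ⟨p, rfl⟩ := hx
      exact ⟨-p, by simp⟩
  · rintro _ ⟨q, rfl⟩
    -- Consecutive partial sums differ by a unit fraction.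
    have hden : ((q.den : ℝ))⁻¹ ∈ AddSubgroup.closure harmonicPartialSums := by
      obtain ⟨d, hd⟩ := Nat.exists_eq_succ_of_ne_zero q.den_nz
      have := sub_mem (hmem (d + 1)) (hmem d)
      rw [harmonic_succ] at this
      rw [hd]
      simpa using this
    have := AddSubgroup.zsmul_mem _ hden q.num
    rw [zsmul_eq_mul, ← div_eq_mul_inv, ← Rat.cast_def] at this
    simpa using this

theorem isDenseCommensurable_harmonicPartialSums :
    IsDenseCommensurable harmonicPartialSums 1 where
  nonempty := ⟨_, 1, le_rfl, rfl⟩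
  pos := by
    rintro _ ⟨n, hn, rfl⟩
    rw [harmonicPartialSum_eq_harmonic]
    exact_mod_cast harmonic_pos (by omega)
  bounded_away := by
    refine ⟨1, one_pos, ?_⟩
    rintro _ ⟨n, hn, rfl⟩
    calc (1 : ℝ) = 1 / ((1 : ℕ) : ℝ) := by simp
      _ ≤ _ := Finset.single_le_sum (f := fun i : ℕ => 1 / (i : ℝ)) (fun i _ => by positivity)
        (Finset.mem_Icc.2 ⟨le_rfl, hn⟩)
  dense := by
    rw [closure_harmonicPartialSums]
    simpa [rationalMultiples, DenseRange] using Rat.denseRange_cast (𝕜 := ℝ)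
  base_pos := one_pos
  closure_subset := closure_harmonicPartialSums.subset
  finite := by
    intro N
    -- Since `log (n + 1) ≤ harmonic n`, a partial sum at most `N` has `n + 1 ≤ exp N`.
    obtain ⟨M, hM⟩ := exists_nat_gt (Real.exp N)
    refine ((Set.finite_Iic M).image fun n => (harmonic n : ℝ)).subset ?_
    rintro _ ⟨⟨n, hn, rfl⟩, -, hle⟩
    rw [harmonicPartialSum_eq_harmonic] at hle ⊢
    refine ⟨n, ?_, rfl⟩
    have h1 := (log_add_one_le_harmonic n).trans hle
    rw [Real.log_le_iff_le_exp (by positivity)] at h1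
    have : ((n + 1 : ℕ) : ℝ) < M := h1.trans_lt hM
    exact (Nat.lt_of_succ_lt (by exact_mod_cast this)).le

theorem proposition4p3 :
    (∀ (S : Set ℝ) (β : ℝ), IsDenseCommensurable S β →
      ∀ (α : ℝ) (hα : 0 < α), LinearIndependent ℚ ![α, β] →
        ¬ ∃ C : Set ((ℕ → Bool) × Set.Ico (0 : ℝ) α),
          (odometer.flowUnder α hα).IsRegularCrossSection S C) ∧
    (IsDenseCommensurable harmonicPartialSums 1 ∧
      (AddSubgroup.closure harmonicPartialSums : Set ℝ) = rationalMultiples 1) :=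
  ⟨fun _ _ hS _ hα hind => not_exists_isRegularCrossSection_odometer hS.base_pos
    (AddSubgroup.subset_closure.trans hS.closure_subset) hS.finite hα hind,
    isDenseCommensurable_harmonicPartialSums, closure_harmonicPartialSums⟩
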